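/- Let $\alpha,\beta,\gamma>-1$ and $\sigma>0$. For $a,c>-1$ let $w_{a,c}(x)=x^{a}(1-x)^{c}$ on $[0,1]$ and $c_{a,c}=\big(\int_0^1 w_{a,c}(x)\,dx\big)^{-1}$. For $f,g\in\mathbb R[x,y]$ put $$\langle f,g\rangle_{\alpha,\beta,\gamma}=c_{\alpha,\gamma}\int_0^1 f(x,1)g(x,1)\,w_{\alpha,\gamma}(x)\,dx+\sigma\,c_{\beta,\gamma}\int_0^1 f(1,y)g(1,y)\,w_{\beta,\gamma}(y)\,dy .$$ Let $I\subset\mathbb R[x,y]$ be the ideal generated by $(1-x)(1-y)$; the form depends only on the classes of $f,g$ modulo $I$. Let $\mathcal H_n^2$ be the set of elements of $\mathbb R[x,y]/I$ that have a representative of total degree at most $n$ and are orthogonal, with respect to $\langle\cdot,\cdot\rangle_{\alpha,\beta,\gamma}$, to all polynomials of total degree less than $n$. Write $(a)_n=a(a+1)\cdots(a+n-1)$, let $P_n^{(a,b)}$ be the usual Jacobi polynomial on $[-1,1]$, $$P_n^{(a,b)}(t)=\sum_{k=0}^{n}\frac{(n+a+b+1)_k\,(a+k+1)_{n-k}}{k!\,(n-k)!}\Big(\frac{t-1}{2}\Big)^k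 ,$$ and let $$h_n^{a,c}=c_{a,c}\int_0^1\big[P_n^{(c,a)}(2x-1)\big]^2 w_{a,c}(x)\,dx .$$ Define, for $n\ge 0$ (so that $P_0=1$), $$P_n(x,y)=P_n^{(\gamma,\alpha)}(2x-1)+P_n^{(\gamma,\beta)}(2y-1)-\binom{n+\gamma}{n},$$ and, for $n\ge1$, $$Q_n(x,y)=\frac{(\gamma+\alpha+2)_n}{(\alpha+1)_{n-1}}(1-x)P_{n-1}^{(\gamma+2,\alpha)}(2x-1)-\sigma^{-1}\frac{(\gamma+\beta+2)_n}{(\beta+1)_{n-1}}(1-y)P_{n-1}^{(\gamma+2,\beta)}(2y-1).$$ **Theorem.** The classes of $P_n$ (for $n\ge0$) and $Q_n$ (for $n\ge1$) belong to $\mathcal H_n^2$. For $n\ge 1$, $$\langle P_n,Q_n\rangle_{\alpha,\beta,\gamma}=\frac{(\beta-\alpha)(\gamma+1)_{n+1}}{(2n+\gamma+\alpha+1)(2n+\gamma+\beta+1)(n-1)!};$$ in particular $P_n$ and $Q_n$ are orthogonal to each other if $\beta=\alpha$. Furthermore, for $n\ge0$, $$\langle P_n,P_n\rangle_{\alpha,\beta,\gamma}=h_n^{\alpha,\gamma}+\sigma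 h_n^{\beta,\gamma},$$ and, for $n\ge1$, $$\langle Q_n,Q_n\rangle_{\alpha,\beta,\gamma}=\frac{(\gamma+1)_2(\alpha+\gamma+2)_n^2}{(\alpha+\gamma+2)_2(\alpha+1)_{n-1}^2}\,h_{n-1}^{\alpha,\gamma+2}+\sigma^{-1}\frac{(\gamma+1)_2(\beta+\gamma+2)_n^2}{(\beta+\gamma+2)_2(\beta+1)_{n-1}^2}\,h_{n-1}^{\beta,\gamma+2}.$$ Here, for all $a,c>-1$ and $n\ge0$ (excluding only $n=0$, $c+a+1=0$, where the right-hand side is $0/0$), $$h_n^{a,c}=\frac{(c+1)_n(a+1)_n(n+c+a+1)}{n!\,(c+a+2)_n(2n+c+a+1)} .$$ -/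

import Mathlib

open MeasureTheory

noncomputable section

/-- The Pochhammer symbol `(a)_n = a (a + 1) ⋯ (a + n - 1)`. -/
def poch (a : ℝ) (n : ℕ) : ℝ := (ascPochhammer ℝ n).eval a

/-- The usual Jacobi polynomial `P_n^{(a,b)}` on `[-1, 1]`, written out in powers of `(t - 1) / 2`:
`P_n^{(a,b)}(t) = ∑_k (n + a + b + 1)_k (a + k + 1)_{n-k} / (k! (n-k)!) ((t - 1) / 2)^k`. -/
def jacobiPoly (n : ℕ) (a b : ℝ) : Polynomial ℝ :=
  ∑ k ∈ Finset.range (n + 1),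
    Polynomial.C (poch (n + a + b + 1) k * poch (a + k + 1) (n - k) /
      ((k.factorial : ℝ) * ((n - k).factorial : ℝ))) *
    (Polynomial.C (1 / 2 : ℝ) * (Polynomial.X - 1)) ^ k

/-- The Jacobi weight `w_{α,γ}(x) = x^α (1 - x)^γ` on `[0, 1]`. -/
def jacobiWeight (α γ : ℝ) (x : ℝ) : ℝ := x ^ α * (1 - x) ^ γ

/-- The constant `c_{α,γ}` that normalizes the weight `w_{α,γ}`. -/
def jacobiConst (α γ : ℝ) : ℝ := (∫ x in (0 : ℝ)..1, jacobiWeight α γ x)⁻¹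

/-- `h_n^{α,γ}`, the normalized squared norm of `P_n^{(γ,α)}(2x - 1)` for the weight `w_{α,γ}`. -/
def jacobiNormSq (n : ℕ) (α γ : ℝ) : ℝ :=
  jacobiConst α γ *
    ∫ x in (0 : ℝ)..1, ((jacobiPoly n γ α).eval (2 * x - 1)) ^ 2 * jacobiWeight α γ x

/-- The form `⟨f, g⟩_{w₁,w₂}` on the wedge
`{(x, 1) : x ∈ [0, 1]} ∪ {(1, y) : y ∈ [0, 1]}`. -/
def wedgeForm (w₁ w₂ : ℝ → ℝ) (f g : MvPolynomial (Fin 2) ℝ) : ℝ :=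
  (∫ x in (0 : ℝ)..1,
    MvPolynomial.eval ![x, 1] f * MvPolynomial.eval ![x, 1] g * w₁ x) +
  ∫ y in (0 : ℝ)..1,
    MvPolynomial.eval ![1, y] f * MvPolynomial.eval ![1, y] g * w₂ y

/-- The ideal `I` of `ℝ[x, y]` generated by `(1 - x) (1 - y)`. -/
def wedgeIdeal : Ideal (MvPolynomial (Fin 2) ℝ) :=
  Ideal.span {(1 - MvPolynomial.X 0) * (1 - MvPolynomial.X 1)}

/-- The form only depends on the first argument modulo `I`. -/
theorem wedgeForm_congr_left (w₁ w₂ : ℝ → ℝ) {f f' : MvPolynomial (Fin 2) ℝ}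
    (h : Ideal.Quotient.mk wedgeIdeal f = Ideal.Quotient.mk wedgeIdeal f')
    (g : MvPolynomial (Fin 2) ℝ) : wedgeForm w₁ w₂ f g = wedgeForm w₁ w₂ f' g := by
  rw [Ideal.Quotient.eq, wedgeIdeal, Ideal.mem_span_singleton] at h
  obtain ⟨q, hq⟩ := h
  have h1 : ∀ x : ℝ, MvPolynomial.eval ![x, 1] f = MvPolynomial.eval ![x, 1] f' := by
    intro x
    have := congrArg (MvPolynomial.eval ![x, 1]) hq
    simp at this
    linarith
  have h2 : ∀ y : ℝ, MvPolynomial.eval ![1, y] f = MvPolynomial.eval ![1, y] f' := by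
    intro y
    have := congrArg (MvPolynomial.eval ![1, y]) hq
    simp at this
    linarith
  simp only [wedgeForm, h1, h2]

/-- The form is symmetric, so that it descends to `ℝ[x, y] / I` in both arguments. -/
theorem wedgeForm_comm (w₁ w₂ : ℝ → ℝ) (f g : MvPolynomial (Fin 2) ℝ) :
    wedgeForm w₁ w₂ f g = wedgeForm w₁ w₂ g f := by
  unfold wedgeForm
  congr 1 <;> (congr 1; funext x; ring)

/-- `H_n²(w₁, w₂)`: the elements of `ℝ[x, y] / I` that are represented by a polynomial of total
degree at most `n` and are orthogonal to all polynomials of total degree less than `n`. -/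
def wedgeOrthSpace (w₁ w₂ : ℝ → ℝ) (n : ℕ) : Set (MvPolynomial (Fin 2) ℝ ⧸ wedgeIdeal) :=
  {F | ∃ f : MvPolynomial (Fin 2) ℝ, Ideal.Quotient.mk wedgeIdeal f = F ∧ f.totalDegree ≤ n ∧
    ∀ g : MvPolynomial (Fin 2) ℝ, g.totalDegree < n → wedgeForm w₁ w₂ f g = 0}

/-- The weight `c_{α,γ} w_{α,γ}` on the edge `y = 1`. -/
def wedgeWeightX (α γ : ℝ) (x : ℝ) : ℝ := jacobiConst α γ * jacobiWeight α γ x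

/-- The weight `σ c_{β,γ} w_{β,γ}` on the edge `x = 1`. -/
def wedgeWeightY (β γ σ : ℝ) (y : ℝ) : ℝ := σ * jacobiConst β γ * jacobiWeight β γ y

/-- The form `⟨f, g⟩_{α,β,γ}` (which also depends on `σ`). -/
def jacobiWedgeForm (α β γ σ : ℝ) (f g : MvPolynomial (Fin 2) ℝ) : ℝ :=
  wedgeForm (wedgeWeightX α γ) (wedgeWeightY β γ σ) f g

/-- `H_n²` for the form `⟨·, ·⟩_{α,β,γ}`. -/
def jacobiWedgeOrthSpace (α β γ σ : ℝ) (n : ℕ) : Set (MvPolynomial (Fin 2) ℝ ⧸ wedgeIdeal) :=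
  wedgeOrthSpace (wedgeWeightX α γ) (wedgeWeightY β γ σ) n

/-- `P_n^{(a,b)}(2 x_i - 1)` as a polynomial in two variables, `x_0 = x` and `x_1 = y`. -/
def jacobiIn (n : ℕ) (a b : ℝ) (i : Fin 2) : MvPolynomial (Fin 2) ℝ :=
  Polynomial.aeval (2 * MvPolynomial.X i - 1 : MvPolynomial (Fin 2) ℝ) (jacobiPoly n a b)

/-- `P_n(x, y) = P_n^{(γ,α)}(2x - 1) + P_n^{(γ,β)}(2y - 1) - binom(n + γ, n)`. -/
def wedgeP (α β γ : ℝ) (n : ℕ) : MvPolynomial (Fin 2) ℝ :=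
  jacobiIn n γ α 0 + jacobiIn n γ β 1 - MvPolynomial.C (Ring.choose ((n : ℝ) + γ) n)

/-- For `n = 0` the formula gives the constant `1`. -/
theorem wedgeP_zero (α β γ : ℝ) : wedgeP α β γ 0 = 1 := by
  simp [wedgeP, jacobiIn, jacobiPoly, poch]

/-- `Q_n(x, y)`; only used for `n ≥ 1`. -/
def wedgeQ (α β γ σ : ℝ) (n : ℕ) : MvPolynomial (Fin 2) ℝ :=
  MvPolynomial.C (poch (γ + α + 2) n / poch (α + 1) (n - 1)) *
      (1 - MvPolynomial.X 0) * jacobiIn (n - 1) (γ + 2) α 0 -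
    MvPolynomial.C (σ⁻¹ * (poch (γ + β + 2) n / poch (β + 1) (n - 1))) *
      (1 - MvPolynomial.X 1) * jacobiIn (n - 1) (γ + 2) β 1

end

/-! Modulo `wedgeIdeal` a polynomial is its pair of restrictions to the two edges, so everything
reduces to one-variable Jacobi integrals, written in u = 1 - x (or 1 - y), which puts the common
corner (1,1) at u = 0. The binomial makes `wedgeP` restrict to a single Jacobi polynomial on each
edge, so its orthogonality and norm are the classical ones, edge by edge. `wedgeQ` restricts to a
multiple of u P_{n-1}^{(γ+2,·)}. Against g of degree below n, the part of g divisible by u produces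
the weight with exponent γ+2 and vanishes, leaving only g(1,1). The constants in Q_n make each edge
give (γ+1) g(1,1) with opposite signs. The engine is `jacobiMoment_shiftedJacobi`, the integral of
P_n^{(c,a)} against x^a (1-x)^(c+s) for real s, which carries the factor (-s)_n: s = j < n gives
orthogonality, s = n the norm, s = -1 the value at the corner. It follows by induction from
`shiftedJacobi_succ` and integration by parts, without Gamma functions. -/

noncomputable section

/-! ### Moments of the Jacobi weight. -/

theorem intervalIntegrable_jacobiWeight {a d : ℝ} (ha : -1 < a) (hd : -1 < d) :
    IntervalIntegrable (jacobiWeight a d) volume 0 1 := by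
  have left : ∀ {a d : ℝ}, -1 < a →
      IntervalIntegrable (fun x : ℝ => x ^ a * (1 - x) ^ d) volume 0 (1 / 2) := by
    intro a d ha
    refine (intervalIntegral.intervalIntegrable_rpow' ha).mul_continuousOn ?_
    refine (continuousOn_const.sub continuousOn_id).rpow_const fun x hx => Or.inl ?_
    rw [Set.uIcc_of_le (by norm_num)] at hx
    intro h
    have h' : 1 - x = 0 := h
    linarith [hx.2]
  -- The right half is the left half with the exponents exchanged, reflected by x ↦ 1 - x.
  refine (left ha).trans ?_
  have h := (left (d := a) hd).comp_sub_left 1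
  norm_num at h
  have h2 := h.symm
  norm_num [mul_comm] at h2
  exact h2

/-- The integral of `p (1 - x)` for the Jacobi weight `w_{a,d}`. -/
def jacobiMoment (a d : ℝ) (p : Polynomial ℝ) : ℝ :=
  ∫ x in (0 : ℝ)..1, p.eval (1 - x) * jacobiWeight a d x

theorem intervalIntegrable_eval_mul_jacobiWeight {a d : ℝ} (ha : -1 < a) (hd : -1 < d)
    (p : Polynomial ℝ) :
    IntervalIntegrable (fun x => p.eval (1 - x) * jacobiWeight a d x) volume 0 1 :=
  (intervalIntegrable_jacobiWeight ha hd).continuousOn_mul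
    (p.continuous.comp (continuous_const.sub continuous_id)).continuousOn

theorem jacobiMoment_add {a d : ℝ} (ha : -1 < a) (hd : -1 < d) (p q : Polynomial ℝ) :
    jacobiMoment a d (p + q) = jacobiMoment a d p + jacobiMoment a d q := by
  unfold jacobiMoment
  rw [← intervalIntegral.integral_add (intervalIntegrable_eval_mul_jacobiWeight ha hd p)
    (intervalIntegrable_eval_mul_jacobiWeight ha hd q)]
  simp only [Polynomial.eval_add, add_mul]

theorem jacobiMoment_C_mul (a d r : ℝ) (p : Polynomial ℝ) :
    jacobiMoment a d (Polynomial.C r * p) = r * jacobiMoment a d p := by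
  unfold jacobiMoment
  rw [← intervalIntegral.integral_const_mul]
  simp only [Polynomial.eval_mul, Polynomial.eval_C, mul_assoc]

theorem jacobiMoment_sum {a d : ℝ} (ha : -1 < a) (hd : -1 < d) {ι : Type*} (s : Finset ι)
    (p : ι → Polynomial ℝ) :
    jacobiMoment a d (∑ i ∈ s, p i) = ∑ i ∈ s, jacobiMoment a d (p i) := by
  classical
  induction s using Finset.induction_on with
  | empty => simp [jacobiMoment]
  | insert i s hi ih => rw [Finset.sum_insert hi, Finset.sum_insert hi, jacobiMoment_add ha hd, ih]

theorem jacobiMoment_X_mul (a : ℝ) {d : ℝ} (hd : -1 < d) (p : Polynomial ℝ) :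
    jacobiMoment a d (Polynomial.X * p) = jacobiMoment a (d + 1) p := by
  refine intervalIntegral.integral_congr fun x hx => ?_
  rw [Set.uIcc_of_le zero_le_one] at hx
  simp only [jacobiWeight, Polynomial.eval_mul, Polynomial.eval_X]
  -- At x = 1 the base is 0, so the exponent d + 1 has to be nonzero.
  rw [Real.rpow_add_one' (by linarith [hx.2]) (by linarith)]
  ring

theorem jacobiMoment_X_pow_mul (a : ℝ) {d : ℝ} (hd : -1 < d) (p : Polynomial ℝ) (j : ℕ) :
    jacobiMoment a d (Polynomial.X ^ j * p) = jacobiMoment a (d + j) p := by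
  induction j generalizing d with
  | zero => simp
  | succ j ih =>
    rw [pow_succ', mul_assoc, jacobiMoment_X_mul a hd, ih (by linarith)]
    push_cast
    ring_nf

theorem jacobiMoment_one_sub_X_mul {a : ℝ} (ha : -1 < a) (d : ℝ) (p : Polynomial ℝ) :
    jacobiMoment a d ((1 - Polynomial.X) * p) = jacobiMoment (a + 1) d p := by
  refine intervalIntegral.integral_congr fun x hx => ?_
  rw [Set.uIcc_of_le zero_le_one] at hx
  simp only [jacobiWeight, Polynomial.eval_mul, Polynomial.eval_X, Polynomial.eval_sub,
    Polynomial.eval_one]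
  rw [Real.rpow_add_one' hx.1 (by linarith)]
  ring

/-- Integration by parts for the Jacobi weight. -/
theorem jacobiMoment_deriv {a d : ℝ} (ha : -1 < a) (hd : -1 < d) (q : Polynomial ℝ) :
    jacobiMoment a d (Polynomial.C (a + 1) * (Polynomial.X * q) -
      Polynomial.C (d + 1) * ((1 - Polynomial.X) * q) -
      (1 - Polynomial.X) * (Polynomial.X * Polynomial.derivative q)) = 0 := by
  -- The antiderivative vanishes at both ends because a + 1 and d + 1 are positive.
  have key := intervalIntegral.integral_eq_sub_of_hasDerivAt_of_le (zero_le_one (α := ℝ))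
    (f := fun x => x ^ (a + 1) * (1 - x) ^ (d + 1) * q.eval (1 - x))
    (f' := fun x => (Polynomial.C (a + 1) * (Polynomial.X * q) -
      Polynomial.C (d + 1) * ((1 - Polynomial.X) * q) -
      (1 - Polynomial.X) * (Polynomial.X * Polynomial.derivative q)).eval (1 - x) *
        jacobiWeight a d x) ?_ ?_ (intervalIntegrable_eval_mul_jacobiWeight ha hd _)
  · rw [jacobiMoment, key]
    simp [Real.zero_rpow (show a + 1 ≠ 0 by linarith), Real.zero_rpow (show d + 1 ≠ 0 by linarith)]
  · refine Continuous.continuousOn ?_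
    refine ((Real.continuous_rpow_const (by linarith)).mul
      ((Real.continuous_rpow_const (by linarith)).comp (continuous_const.sub continuous_id))).mul
      (q.continuous.comp (continuous_const.sub continuous_id))
  · intro x hx
    have hx0 : x ≠ 0 := hx.1.ne'
    have hx1 : 1 - x ≠ 0 := by linarith [hx.2]
    have hs : HasDerivAt (fun x : ℝ => 1 - x) (-1) x := by
      simpa using (hasDerivAt_id x).const_sub 1
    have h1 := Real.hasDerivAt_rpow_const (p := a + 1) (Or.inl hx0)
    have h2 := hs.rpow_const (p := d + 1) (Or.inl hx1)
    have h3 := (q.hasDerivAt (1 - x)).comp x hs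
    refine ((h1.mul h2).mul h3).congr_deriv ?_
    simp only [jacobiWeight, Polynomial.eval_mul, Polynomial.eval_X, Polynomial.eval_sub,
      Polynomial.eval_one, Polynomial.eval_C, add_sub_cancel_right, Function.comp, Pi.mul_apply]
    rw [Real.rpow_add_one hx0, Real.rpow_add_one hx1]
    ring

theorem jacobiMoment_one (a d : ℝ) :
    jacobiMoment a d 1 = ∫ x in (0 : ℝ)..1, jacobiWeight a d x := by
  simp [jacobiMoment]

theorem jacobiMoment_one_pos {a d : ℝ} (ha : -1 < a) (hd : -1 < d) : 0 < jacobiMoment a d 1 := by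
  rw [jacobiMoment_one]
  refine intervalIntegral.intervalIntegral_pos_of_pos_on (intervalIntegrable_jacobiWeight ha hd)
    (fun x hx => ?_) zero_lt_one
  exact mul_pos (Real.rpow_pos_of_pos hx.1 _) (Real.rpow_pos_of_pos (by linarith [hx.2]) _)

/-- Integration by parts with q = 1, and 1 = u + (1 - u). These two linear relations determine both
shifted Beta integrals from the unshifted one. -/
theorem jacobiMoment_one_shift {a d : ℝ} (ha : -1 < a) (hd : -1 < d) :
    (a + 1) * jacobiMoment a (d + 1) 1 = (d + 1) * jacobiMoment (a + 1) d 1 ∧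
      jacobiMoment a d 1 = jacobiMoment a (d + 1) 1 + jacobiMoment (a + 1) d 1 := by
  have h1 := jacobiMoment_X_mul a hd 1
  have h2 := jacobiMoment_one_sub_X_mul ha d 1
  constructor
  · have h := jacobiMoment_deriv ha hd 1
    rw [Polynomial.derivative_one, mul_zero, mul_zero, sub_zero, sub_eq_add_neg, ← neg_mul,
      ← Polynomial.C_neg, jacobiMoment_add ha hd, jacobiMoment_C_mul, jacobiMoment_C_mul, h1,
      h2] at h
    linarith
  · rw [← h1, ← h2, ← jacobiMoment_add ha hd]
    congr 1
    ring

theorem jacobiMoment_one_succ_left {a d : ℝ} (ha : -1 < a) (hd : -1 < d) :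
    jacobiMoment (a + 1) d 1 = (a + 1) / (a + d + 2) * jacobiMoment a d 1 := by
  obtain ⟨h1, h2⟩ := jacobiMoment_one_shift ha hd
  have : a + d + 2 ≠ 0 := by linarith
  field_simp
  linear_combination -h1 - (a + 1) * h2

theorem jacobiMoment_one_succ_right {a d : ℝ} (ha : -1 < a) (hd : -1 < d) :
    jacobiMoment a (d + 1) 1 = (d + 1) / (a + d + 2) * jacobiMoment a d 1 := by
  obtain ⟨h1, h2⟩ := jacobiMoment_one_shift ha hd
  have : a + d + 2 ≠ 0 := by linarith
  field_simp
  linear_combination h1 - (d + 1) * h2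

/-! ### Pochhammer symbols. -/

theorem poch_zero (a : ℝ) : poch a 0 = 1 := by simp [poch]

theorem poch_succ (a : ℝ) (n : ℕ) : poch a (n + 1) = poch a n * (a + n) :=
  ascPochhammer_succ_eval n a

theorem poch_succ_left (a : ℝ) (n : ℕ) : poch a (n + 1) = a * poch (a + 1) n := by
  simp [poch, ascPochhammer_succ_left]

theorem poch_pos {a : ℝ} (ha : 0 < a) (n : ℕ) : 0 < poch a n := ascPochhammer_pos n a ha

theorem poch_one (n : ℕ) : poch 1 n = n.factorial := by
  simp [poch]

theorem poch_neg_natCast_of_lt {j n : ℕ} (h : j < n) : poch (-(j : ℝ)) n = 0 :=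
  ascPochhammer_eval_neg_coe_nat_of_lt h

theorem poch_neg_natCast_self (n : ℕ) : poch (-(n : ℝ)) n = (-1) ^ n * n.factorial := by
  induction n with
  | zero => simp [poch_zero]
  | succ n ih =>
    have h : -((n + 1 : ℕ) : ℝ) + 1 = -(n : ℝ) := by push_cast; ring
    rw [poch_succ_left, h, ih, Nat.factorial_succ]
    push_cast
    ring

/-- Matches the corner value of the Jacobi polynomial with the constant subtracted in `wedgeP`. -/
theorem poch_div_factorial_eq_choose (c : ℝ) (n : ℕ) :
    poch (c + 1) n / n.factorial = Ring.choose ((n : ℝ) + c) n := by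
  have h : (n : ℝ) + c - n + 1 = c + 1 := by ring
  have h2 := Ring.descPochhammer_eq_factorial_smul_choose ((n : ℝ) + c) n
  rw [Polynomial.descPochhammer_smeval_eq_ascPochhammer, h,
    Polynomial.ascPochhammer_smeval_eq_eval, nsmul_eq_mul] at h2
  rw [poch, h2]
  field_simp

/-! ### Jacobi polynomials in powers of 1 - x. -/

/-- The coefficient of `(1 - x) ^ k` in `P_n^{(c,a)}(2x - 1)`. -/
def jacobiCoeff (n : ℕ) (c a : ℝ) (k : ℕ) : ℝ :=
  (-1) ^ k * (poch (n + c + a + 1) k * poch (c + k + 1) (n - k) /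
    ((k.factorial : ℝ) * ((n - k).factorial : ℝ)))

/-- The Jacobi polynomial `P_n^{(c,a)}(2x - 1)` as a polynomial in `1 - x`. -/
def shiftedJacobi (n : ℕ) (c a : ℝ) : Polynomial ℝ :=
  ∑ k ∈ Finset.range (n + 1), Polynomial.C (jacobiCoeff n c a k) * Polynomial.X ^ k

theorem eval_shiftedJacobi (n : ℕ) (c a x : ℝ) :
    (shiftedJacobi n c a).eval (1 - x) = (jacobiPoly n c a).eval (2 * x - 1) := by
  simp only [shiftedJacobi, jacobiPoly, Polynomial.eval_finsetSum, Polynomial.eval_mul,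
    Polynomial.eval_C, Polynomial.eval_pow, Polynomial.eval_X, Polynomial.eval_sub,
    Polynomial.eval_one, jacobiCoeff]
  refine Finset.sum_congr rfl fun k _ => ?_
  have h : (1 / 2 * (2 * x - 1 - 1) : ℝ) = -1 * (1 - x) := by ring
  rw [h, mul_pow]
  ring

theorem coeff_shiftedJacobi (n : ℕ) (c a : ℝ) (k : ℕ) :
    (shiftedJacobi n c a).coeff k = if k ≤ n then jacobiCoeff n c a k else 0 := by
  simp [shiftedJacobi, Polynomial.coeff_X_pow]

theorem natDegree_shiftedJacobi_le (n : ℕ) (c a : ℝ) : (shiftedJacobi n c a).natDegree ≤ n := by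
  rw [Polynomial.natDegree_le_iff_coeff_eq_zero]
  intro k hk
  rw [coeff_shiftedJacobi, if_neg (by omega)]

theorem shiftedJacobi_zero (c a : ℝ) : shiftedJacobi 0 c a = 1 := by
  simp [shiftedJacobi, jacobiCoeff, poch_zero]

theorem shiftedJacobi_eval_zero (n : ℕ) (c a : ℝ) :
    (shiftedJacobi n c a).eval 0 = poch (c + 1) n / n.factorial := by
  rw [← Polynomial.coeff_zero_eq_eval_zero, coeff_shiftedJacobi]
  simp [jacobiCoeff, poch_zero]

theorem jacobiCoeff_top (n : ℕ) (c a : ℝ) :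
    jacobiCoeff n c a n = (-1) ^ n * (poch (n + c + a + 1) n / n.factorial) := by
  simp [jacobiCoeff, poch_zero]

/-- This lemma and the next two are the constant, middle and top coefficients of
`shiftedJacobi_succ`. -/
theorem jacobiCoeff_zero_succ (n : ℕ) (c a : ℝ) :
    (c + 1) * jacobiCoeff n (c + 1) (a + 1) 0 = (n + 1) * jacobiCoeff (n + 1) c a 0 := by
  simp only [jacobiCoeff, poch_zero, Nat.sub_zero, Nat.factorial_zero, Nat.factorial_succ]
  have h := poch_succ_left (c + 1) n
  push_cast
  rw [add_zero, add_zero, h]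
  field_simp

/-- Writing the degree as k + 1 + m avoids truncated subtraction in the factorials and Pochhammer
lengths. -/
theorem jacobiCoeff_succ_succ (m k : ℕ) (c a : ℝ) :
    (c + k + 2) * jacobiCoeff (k + 1 + m) (c + 1) (a + 1) (k + 1) -
      (a + c + k + 2) * jacobiCoeff (k + 1 + m) (c + 1) (a + 1) k =
    (k + m + 2) * jacobiCoeff (k + 1 + m + 1) c a (k + 1) := by
  have e1 : k + 1 + m - (k + 1) = m := by omega
  have e2 : k + 1 + m - k = m + 1 := by omega
  have e3 : k + 1 + m + 1 - (k + 1) = m + 1 := by omega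
  simp only [jacobiCoeff, e1, e2, e3, Nat.factorial_succ]
  have h1 := poch_succ_left (c + k + 2) m
  have h2 : poch (c + 1 + k + 1) (m + 1) = poch (c + k + 2) (m + 1) := by congr 1; ring
  have h3 : poch (c + 1 + (k + 1 : ℕ) + 1) m = poch (c + k + 2 + 1) m := by
    congr 1; push_cast; ring
  have h4 : poch (c + (k + 1 : ℕ) + 1) (m + 1) = poch (c + k + 2) (m + 1) := by
    congr 1; push_cast; ring
  have h5 := poch_succ (k + m + c + a + 4) k
  have h6 := poch_succ_left (k + m + c + a + 3) k
  have h7 : ∀ j, poch ((k + 1 + m : ℕ) + (c + 1) + (a + 1) + 1) j = poch (k + m + c + a + 4) j := by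
    intro j; congr 1; push_cast; ring
  have h8 : poch ((k + 1 + m + 1 : ℕ) + c + a + 1) (k + 1) =
      poch (k + m + c + a + 3) (k + 1) := by congr 1; push_cast; ring
  have h9 : (k : ℝ) + m + c + a + 3 + 1 = k + m + c + a + 4 := by ring
  rw [h2, h3, h4, h7, h7, h8, h5, h6, h1, h9]
  push_cast
  field_simp
  ring

theorem jacobiCoeff_top_succ (n : ℕ) (c a : ℝ) :
    -(a + c + n + 2) * jacobiCoeff n (c + 1) (a + 1) n =
      (n + 1) * jacobiCoeff (n + 1) c a (n + 1) := by
  rw [jacobiCoeff_top, jacobiCoeff_top]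
  have h1 : poch (n + (c + 1) + (a + 1) + 1) n = poch (a + c + n + 2 + 1) n := by
    congr 1; ring
  have h2 : poch ((n + 1 : ℕ) + c + a + 1) (n + 1) = poch (a + c + n + 2) (n + 1) := by
    congr 1; push_cast; ring
  rw [h1, h2, poch_succ_left, Nat.factorial_succ]
  push_cast
  field_simp
  ring

/-- The differentiated Rodrigues formula, written in the variable `1 - x`. -/
theorem shiftedJacobi_succ (n : ℕ) (c a : ℝ) :
    Polynomial.C ((n : ℝ) + 1) * shiftedJacobi (n + 1) c a =
      Polynomial.C (c + 1) * ((1 - Polynomial.X) * shiftedJacobi n (c + 1) (a + 1)) -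
      Polynomial.C (a + 1) * (Polynomial.X * shiftedJacobi n (c + 1) (a + 1)) +
      (1 - Polynomial.X) * (Polynomial.X *
        Polynomial.derivative (shiftedJacobi n (c + 1) (a + 1))) := by
  ext k
  rcases k with _ | k
  · simp only [sub_mul, one_mul, Polynomial.coeff_add, Polynomial.coeff_sub,
      Polynomial.coeff_C_mul, Polynomial.coeff_X_mul_zero, coeff_shiftedJacobi]
    simp only [Nat.zero_le, if_true]
    linarith [jacobiCoeff_zero_succ n c a]
  · have h : (Polynomial.X * (Polynomial.X *
        Polynomial.derivative (shiftedJacobi n (c + 1) (a + 1)))).coeff (k + 1) =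
        k * (shiftedJacobi n (c + 1) (a + 1)).coeff k := by
      rcases k with _ | k
      · simp
      · rw [Polynomial.coeff_X_mul, Polynomial.coeff_X_mul, Polynomial.coeff_derivative]
        push_cast
        ring
    simp only [sub_mul, one_mul, Polynomial.coeff_add, Polynomial.coeff_sub,
      Polynomial.coeff_C_mul, h]
    simp only [Polynomial.coeff_X_mul, Polynomial.coeff_derivative, coeff_shiftedJacobi]
    rcases lt_trichotomy k n with hk | rfl | hk
    · obtain ⟨m, rfl⟩ := Nat.exists_eq_add_of_lt hk
      have e : k + m + 1 = k + 1 + m := by ring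
      rw [e, if_pos (by omega), if_pos (by omega), if_pos (by omega)]
      have := jacobiCoeff_succ_succ m k c a
      push_cast
      linear_combination -this
    · rw [if_pos le_rfl, if_neg (by omega), if_pos le_rfl]
      linear_combination -jacobiCoeff_top_succ k c a
    · rw [if_neg (by omega), if_neg (by omega), if_neg (by omega)]
      ring

/-! ### Integrals of Jacobi polynomials, orthogonality and norms. -/

/-- For s = 0 and positive degree the integrand is a total derivative. In general, integration by
parts leaves s times the integral with (n+1, a, c, s) replaced by (n, a+1, c+1, s-1), and iteration
builds (-s)_n. The induction lowers s, so s must be allowed to be negative. -/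
theorem jacobiMoment_shiftedJacobi (n : ℕ) {a c s : ℝ} (ha : -1 < a) (hs : -1 < c + s) :
    jacobiMoment a (c + s) (shiftedJacobi n c a) =
      jacobiMoment a (c + s) 1 * (poch (a + 1) n * poch (-s) n /
        (n.factorial * poch (a + c + s + 2) n)) := by
  induction n generalizing a c s with
  | zero => simp [shiftedJacobi_zero, poch_zero]
  | succ n ih =>
    set Q := shiftedJacobi n (c + 1) (a + 1) with hQ
    have h1 := jacobiMoment_deriv ha hs Q
    have h2 : Polynomial.C (-((n : ℝ) + 1)) * shiftedJacobi (n + 1) c a =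
        (Polynomial.C (a + 1) * (Polynomial.X * Q) -
          Polynomial.C (c + s + 1) * ((1 - Polynomial.X) * Q) -
          (1 - Polynomial.X) * (Polynomial.X * Polynomial.derivative Q)) +
        Polynomial.C s * ((1 - Polynomial.X) * Q) := by
      have := shiftedJacobi_succ n c a
      rw [← hQ] at this
      rw [Polynomial.C_neg, neg_mul, this]
      simp only [Polynomial.C_add]
      ring
    have h3 := congrArg (jacobiMoment a (c + s)) h2
    rw [jacobiMoment_add ha hs, h1, jacobiMoment_C_mul, jacobiMoment_C_mul,
      jacobiMoment_one_sub_X_mul ha, hQ] at h3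
    -- Raising c and lowering s leaves the exponent of 1 - x unchanged, so the induction hypothesis
    -- applies to this weight.
    have e : c + s = c + 1 + (s - 1) := by ring
    have h4 : jacobiMoment (a + 1) (c + s) (shiftedJacobi n (c + 1) (a + 1)) =
        jacobiMoment (a + 1) (c + 1 + (s - 1)) 1 * (poch (a + 1 + 1) n * poch (-(s - 1)) n /
          (n.factorial * poch (a + 1 + (c + 1) + (s - 1) + 2) n)) := by
      rw [e]
      exact ih (a := a + 1) (by linarith) (by linarith)
    have e2 : a + 1 + (c + 1) + (s - 1) + 2 = a + c + s + 2 + 1 := by ring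
    have e3 : -(s - 1) = -s + 1 := by ring
    rw [h4, ← e, jacobiMoment_one_succ_left ha hs, e2, e3] at h3
    have p1 := poch_pos (show 0 < a + c + s + 2 + 1 by linarith) n
    have p2 : a + c + s + 2 ≠ 0 := by linarith
    rw [poch_succ_left (a + 1), poch_succ_left (-s), poch_succ_left (a + c + s + 2),
      Nat.factorial_succ]
    rw [← add_assoc] at h3
    have p3 : (n : ℝ) + 1 ≠ 0 := by positivity
    have h5 : jacobiMoment a (c + s) (shiftedJacobi (n + 1) c a) = -((n : ℝ) + 1)⁻¹ *
        (-(n + 1) * jacobiMoment a (c + s) (shiftedJacobi (n + 1) c a)) := by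
      field_simp
    rw [h5, h3]
    push_cast
    field_simp
    ring

theorem jacobiMoment_add_natCast_one (n : ℕ) {a c : ℝ} (ha : -1 < a) (hc : -1 < c) :
    jacobiMoment a (c + n) 1 =
      poch (c + 1) n / poch (a + c + 2) n * jacobiMoment a c 1 := by
  induction n with
  | zero => simp [poch_zero]
  | succ n ih =>
    have hn : (0 : ℝ) ≤ n := n.cast_nonneg
    have p1 := poch_pos (show 0 < a + c + 2 by linarith) n
    have p2 : a + c + 2 + n ≠ 0 := by linarith
    have p3 : a + (c + n) + 2 ≠ 0 := by linarith
    push_cast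
    rw [← add_assoc, jacobiMoment_one_succ_right ha (by linarith), ih, poch_succ, poch_succ]
    field_simp
    ring

/-- The Jacobi polynomial of degree `n` sees only the coefficient of degree `n` of a polynomial of
degree at most `n`. -/
theorem jacobiMoment_mul_shiftedJacobi {n : ℕ} {a c : ℝ} (ha : -1 < a) (hc : -1 < c)
    {g : Polynomial ℝ} (hg : g.natDegree ≤ n) :
    jacobiMoment a c (g * shiftedJacobi n c a) =
      g.coeff n * (jacobiMoment a c 1 * ((-1) ^ n * poch (a + 1) n * poch (c + 1) n /
        (poch (a + c + 2) n * poch (a + c + n + 2) n))) := by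
  have hn : (0 : ℝ) ≤ n := n.cast_nonneg
  -- A power u^j of g shifts the exponent by s = j, and (-j)_n = 0 for j < n, so only j = n
  -- survives.
  conv_lhs => rw [g.as_sum_range' (n + 1) (by omega), Finset.sum_mul]
  rw [jacobiMoment_sum ha hc, Finset.sum_range_succ, Finset.sum_eq_zero, zero_add]
  · rw [← Polynomial.C_mul_X_pow_eq_monomial, mul_assoc, jacobiMoment_C_mul,
      jacobiMoment_X_pow_mul a hc, jacobiMoment_shiftedJacobi n ha (by linarith),
      jacobiMoment_add_natCast_one n ha hc, poch_neg_natCast_self]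
    field_simp
  · intro j hj
    have hj0 : (0 : ℝ) ≤ j := j.cast_nonneg
    rw [← Polynomial.C_mul_X_pow_eq_monomial, mul_assoc, jacobiMoment_C_mul,
      jacobiMoment_X_pow_mul a hc, jacobiMoment_shiftedJacobi n ha (by linarith),
      poch_neg_natCast_of_lt (Finset.mem_range.mp hj)]
    simp

theorem jacobiConst_eq (a c : ℝ) : jacobiConst a c = (jacobiMoment a c 1)⁻¹ := by
  rw [jacobiMoment_one, jacobiConst]

theorem jacobiNormSq_eq_moment (n : ℕ) (a c : ℝ) :
    jacobiNormSq n a c =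
      (jacobiMoment a c 1)⁻¹ * jacobiMoment a c (shiftedJacobi n c a * shiftedJacobi n c a) := by
  rw [jacobiNormSq, jacobiConst_eq]
  congr 1
  refine intervalIntegral.integral_congr fun x _ => ?_
  simp only [Polynomial.eval_mul, eval_shiftedJacobi, sq]

theorem jacobiNormSq_eq (n : ℕ) {a c : ℝ} (ha : -1 < a) (hc : -1 < c)
    (h : n ≠ 0 ∨ c + a + 1 ≠ 0) :
    jacobiNormSq n a c =
      poch (c + 1) n * poch (a + 1) n * (n + c + a + 1) /
        ((n.factorial : ℝ) * poch (c + a + 2) n * (2 * n + c + a + 1)) := by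
  have hn : (0 : ℝ) ≤ n := n.cast_nonneg
  -- Since c + a + 1 > -1, this denominator can vanish only for n = 0, which is where `h` is needed.
  have hne : 2 * (n : ℝ) + c + a + 1 ≠ 0 := by
    rcases Nat.eq_zero_or_pos n with rfl | hp
    · simpa using h
    · have : (1 : ℝ) ≤ n := by exact_mod_cast hp
      linarith
  -- Both sides are (n+c+a+1)_{n+1}, split off at its first and at its last factor.
  have h1 : (n + c + a + 1) * poch (a + c + n + 2) n =
      poch (n + c + a + 1) n * (2 * n + c + a + 1) := by
    have e1 : a + c + n + 2 = n + c + a + 1 + 1 := by ring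
    rw [e1, ← poch_succ_left, poch_succ]
    ring
  have p1 := poch_pos (show 0 < a + c + 2 by linarith) n
  have p2 := poch_pos (show 0 < a + c + n + 2 by linarith) n
  have p3 := jacobiMoment_one_pos ha hc
  have e2 : c + a + 2 = a + c + 2 := by ring
  rw [jacobiNormSq_eq_moment, jacobiMoment_mul_shiftedJacobi ha hc
    (natDegree_shiftedJacobi_le n c a), coeff_shiftedJacobi, if_pos le_rfl, jacobiCoeff_top, e2]
  have h2 : ((-1 : ℝ) ^ n) * (-1) ^ n = 1 := by rw [← mul_pow]; simp
  generalize 2 * (n : ℝ) + c + a + 1 = D at hne h1 ⊢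
  replace h1 := (eq_div_iff hne).mpr h1.symm
  rw [h1]
  field_simp
  rw [sq, h2, one_mul]

/-! ### Restriction to the edges and degree bounds. -/

theorem MvPolynomial.natDegree_aeval_le {τ R : Type*} [CommRing R] (v : τ → Polynomial R)
    (hv : ∀ i, (v i).natDegree ≤ 1) (f : MvPolynomial τ R) :
    (MvPolynomial.aeval v f).natDegree ≤ f.totalDegree := by
  rw [MvPolynomial.aeval_def, MvPolynomial.eval₂_eq]
  refine Polynomial.natDegree_sum_le_of_forall_le _ _ fun s hs => ?_
  refine (Polynomial.natDegree_C_mul_le _ _).trans ?_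
  refine (Polynomial.natDegree_prod_le _ _).trans ?_
  refine le_trans ?_ (MvPolynomial.le_totalDegree hs)
  refine Finset.sum_le_sum fun i _ => ?_
  refine Polynomial.natDegree_pow_le.trans ?_
  simpa using Nat.mul_le_mul_left (s i) (hv i)

theorem Polynomial.totalDegree_aeval_le {τ R : Type*} [CommRing R] (q : MvPolynomial τ R)
    (hq : q.totalDegree ≤ 1) (p : Polynomial R) :
    (Polynomial.aeval q p).totalDegree ≤ p.natDegree := by
  rw [Polynomial.aeval_eq_sum_range]
  refine MvPolynomial.totalDegree_finsetSum_le fun i hi => ?_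
  refine (MvPolynomial.totalDegree_smul_le _ _).trans
    ((MvPolynomial.totalDegree_pow _ _).trans ?_)
  have := Nat.mul_le_mul_left i hq
  have := Finset.mem_range.mp hi
  omega

/-- The restriction of `f` to the edge `y = 1`, in the variable `1 - x`. -/
def edgeX (f : MvPolynomial (Fin 2) ℝ) : Polynomial ℝ :=
  MvPolynomial.aeval ![1 - Polynomial.X, 1] f

/-- The restriction of `f` to the edge `x = 1`, in the variable `1 - y`. -/
def edgeY (f : MvPolynomial (Fin 2) ℝ) : Polynomial ℝ :=
  MvPolynomial.aeval ![1, 1 - Polynomial.X] f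

theorem eval_edgeX (f : MvPolynomial (Fin 2) ℝ) (u : ℝ) :
    (edgeX f).eval u = MvPolynomial.eval ![1 - u, 1] f := by
  rw [edgeX, ← Polynomial.coe_evalRingHom, MvPolynomial.aeval_def, MvPolynomial.hom_eval₂,
    MvPolynomial.eval, MvPolynomial.coe_eval₂Hom]
  congr 1
  · ext; simp
  · funext i; fin_cases i <;> simp

theorem eval_edgeY (f : MvPolynomial (Fin 2) ℝ) (u : ℝ) :
    (edgeY f).eval u = MvPolynomial.eval ![1, 1 - u] f := by
  rw [edgeY, ← Polynomial.coe_evalRingHom, MvPolynomial.aeval_def, MvPolynomial.hom_eval₂,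
    MvPolynomial.eval, MvPolynomial.coe_eval₂Hom]
  congr 1
  · ext; simp
  · funext i; fin_cases i <;> simp

theorem natDegree_one_sub_X_le : (1 - Polynomial.X : Polynomial ℝ).natDegree ≤ 1 := by
  compute_degree

theorem natDegree_edgeX_le (f : MvPolynomial (Fin 2) ℝ) :
    (edgeX f).natDegree ≤ f.totalDegree := by
  refine MvPolynomial.natDegree_aeval_le _ (fun i => ?_) f
  fin_cases i
  · exact natDegree_one_sub_X_le
  · simp

theorem natDegree_edgeY_le (f : MvPolynomial (Fin 2) ℝ) :
    (edgeY f).natDegree ≤ f.totalDegree := by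
  refine MvPolynomial.natDegree_aeval_le _ (fun i => ?_) f
  fin_cases i
  · simp
  · exact natDegree_one_sub_X_le

/-- Both are the value at the corner (1,1). This is the only coupling between the two edges. -/
theorem coeff_zero_edgeX_eq (f : MvPolynomial (Fin 2) ℝ) :
    (edgeX f).coeff 0 = (edgeY f).coeff 0 := by
  rw [Polynomial.coeff_zero_eq_eval_zero, Polynomial.coeff_zero_eq_eval_zero, eval_edgeX,
    eval_edgeY, sub_zero]

theorem jacobiWedgeForm_eq (α β γ σ : ℝ) (f g : MvPolynomial (Fin 2) ℝ) :
    jacobiWedgeForm α β γ σ f g =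
      (jacobiMoment α γ 1)⁻¹ * jacobiMoment α γ (edgeX f * edgeX g) +
        σ * ((jacobiMoment β γ 1)⁻¹ * jacobiMoment β γ (edgeY f * edgeY g)) := by
  rw [jacobiWedgeForm, wedgeForm]
  congr 1
  · rw [jacobiMoment.eq_1 α γ (edgeX f * edgeX g), ← intervalIntegral.integral_const_mul]
    refine intervalIntegral.integral_congr fun x _ => ?_
    simp only [wedgeWeightX, jacobiConst_eq, Polynomial.eval_mul, eval_edgeX, sub_sub_cancel]
    ring
  · rw [jacobiMoment.eq_1 β γ (edgeY f * edgeY g), ← mul_assoc, ← intervalIntegral.integral_const_mul]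
    refine intervalIntegral.integral_congr fun x _ => ?_
    simp only [wedgeWeightY, jacobiConst_eq, Polynomial.eval_mul, eval_edgeY, sub_sub_cancel]
    ring

/-! ### Degrees and edge restrictions of P_n and Q_n. -/

theorem eval_jacobiIn (n : ℕ) (a b : ℝ) (i : Fin 2) (v : Fin 2 → ℝ) :
    MvPolynomial.eval v (jacobiIn n a b i) = (shiftedJacobi n a b).eval (1 - v i) := by
  rw [eval_shiftedJacobi, jacobiIn, Polynomial.aeval_def, Polynomial.hom_eval₂, Polynomial.eval]
  congr 1
  · ext; simp
  · simp

theorem totalDegree_jacobiIn_le (n : ℕ) (a b : ℝ) (i : Fin 2) :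
    (jacobiIn n a b i).totalDegree ≤ n := by
  refine (Polynomial.totalDegree_aeval_le _ ?_ _).trans ?_
  · refine (MvPolynomial.totalDegree_sub _ _).trans (max_le ?_ (by simp))
    refine (MvPolynomial.totalDegree_mul _ _).trans ?_
    have : (2 : MvPolynomial (Fin 2) ℝ) = MvPolynomial.C 2 := (map_ofNat MvPolynomial.C 2).symm
    rw [this]
    simp
  · refine Polynomial.natDegree_sum_le_of_forall_le _ _ fun k hk => ?_
    have := Finset.mem_range.mp hk
    refine (Polynomial.natDegree_C_mul_le _ _).trans ?_
    refine (Polynomial.natDegree_pow_le_of_le k (m := 1) ?_).trans (by omega)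
    compute_degree

theorem totalDegree_wedgeP_le (α β γ : ℝ) (n : ℕ) : (wedgeP α β γ n).totalDegree ≤ n := by
  refine (MvPolynomial.totalDegree_sub _ _).trans (max_le ?_ (by simp))
  exact (MvPolynomial.totalDegree_add _ _).trans
    (max_le (totalDegree_jacobiIn_le _ _ _ _) (totalDegree_jacobiIn_le _ _ _ _))

theorem totalDegree_wedgeQ_le (α β γ σ : ℝ) (m : ℕ) :
    (wedgeQ α β γ σ (m + 1)).totalDegree ≤ m + 1 := by
  have h : ∀ (r a b : ℝ) (i : Fin 2), (MvPolynomial.C r * (1 - MvPolynomial.X i) *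
      jacobiIn m a b i : MvPolynomial (Fin 2) ℝ).totalDegree ≤ m + 1 := by
    intro r a b i
    refine (MvPolynomial.totalDegree_mul _ _).trans ?_
    have h1 := totalDegree_jacobiIn_le m a b i
    have h2 := MvPolynomial.totalDegree_mul (MvPolynomial.C r)
      (1 - MvPolynomial.X i : MvPolynomial (Fin 2) ℝ)
    have h3 := MvPolynomial.totalDegree_sub (1 : MvPolynomial (Fin 2) ℝ) (MvPolynomial.X i)
    simp only [MvPolynomial.totalDegree_C, MvPolynomial.totalDegree_one,
      MvPolynomial.totalDegree_X] at h2 h3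
    omega
  exact (MvPolynomial.totalDegree_sub _ _).trans (max_le (h _ _ _ _) (h _ _ _ _))

/-- On y = 1 the second Jacobi polynomial takes its corner value, which cancels the binomial. -/
theorem edgeX_wedgeP (α β γ : ℝ) (n : ℕ) : edgeX (wedgeP α β γ n) = shiftedJacobi n γ α := by
  refine Polynomial.funext fun u => ?_
  simp [eval_edgeX, wedgeP, eval_jacobiIn, shiftedJacobi_eval_zero, poch_div_factorial_eq_choose]

theorem edgeY_wedgeP (α β γ : ℝ) (n : ℕ) : edgeY (wedgeP α β γ n) = shiftedJacobi n γ β := by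
  refine Polynomial.funext fun u => ?_
  simp [eval_edgeY, wedgeP, eval_jacobiIn, shiftedJacobi_eval_zero, poch_div_factorial_eq_choose]

/-- The factor 1 - y kills the other summand on this edge. -/
theorem edgeX_wedgeQ (α β γ σ : ℝ) (m : ℕ) : edgeX (wedgeQ α β γ σ (m + 1)) =
    Polynomial.C (poch (γ + α + 2) (m + 1) / poch (α + 1) m) *
      (Polynomial.X * shiftedJacobi m (γ + 2) α) := by
  refine Polynomial.funext fun u => ?_
  simp [eval_edgeX, wedgeQ, eval_jacobiIn, mul_assoc]

theorem edgeY_wedgeQ (α β γ σ : ℝ) (m : ℕ) : edgeY (wedgeQ α β γ σ (m + 1)) =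
    Polynomial.C (-(σ⁻¹ * (poch (γ + β + 2) (m + 1) / poch (β + 1) m))) *
      (Polynomial.X * shiftedJacobi m (γ + 2) β) := by
  refine Polynomial.funext fun u => ?_
  simp [eval_edgeY, wedgeQ, eval_jacobiIn, mul_assoc]

/-! ### Contributions of a single edge. -/

/-- Against a polynomial of degree at most `m`, `(1 - x) P_m^{(c+2,a)}(2x - 1)` evaluates at
`x = 1`, up to a factor. -/
theorem jacobiMoment_X_mul_shiftedJacobi_mul {m : ℕ} {a c : ℝ} (ha : -1 < a) (hc : -1 < c)
    {g : Polynomial ℝ} (hg : g.natDegree ≤ m) :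
    poch (c + a + 2) (m + 1) / poch (a + 1) m * ((jacobiMoment a c 1)⁻¹ *
      jacobiMoment a c (Polynomial.X * shiftedJacobi m (c + 2) a * g)) = (c + 1) * g.coeff 0 := by
  set S := shiftedJacobi m (c + 2) a with hS
  -- Split g = g(0) + u q. The q part carries u², which turns the weight into the one for which S is
  -- orthogonal.
  have hg' : Polynomial.X * S * g = Polynomial.C (g.coeff 0) * (Polynomial.X * S) +
      Polynomial.X * (Polynomial.X * (g.divX * S)) := by
    conv_lhs => rw [← Polynomial.divX_mul_X_add g]
    ring
  have h0 : jacobiMoment a c (Polynomial.X * (Polynomial.X * (g.divX * S))) = 0 := by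
    have e : c + 1 + 1 = c + 2 := by ring
    -- The vanishing coefficient of u^m in q, which is that of u^(m+1) in g, suffices; this also
    -- covers m = 0.
    rw [jacobiMoment_X_mul a hc, jacobiMoment_X_mul a (by linarith), e, hS,
      jacobiMoment_mul_shiftedJacobi ha (by linarith)
        ((Polynomial.natDegree_divX_eq_natDegree_tsub_one).trans_le (by omega)),
      Polynomial.coeff_divX, Polynomial.coeff_eq_zero_of_natDegree_lt (by omega), zero_mul]
  -- The g(0) part has only one factor u, one short of c + 2: this is s = -1, where (-s)_m = (1)_m =
  -- m! cancels the factorial.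
  have e : c + 1 = c + 2 + -1 := by ring
  have h1 : jacobiMoment a (c + 1) S = jacobiMoment a (c + 1) 1 *
      (poch (a + 1) m / poch (c + a + 2 + 1) m) := by
    have h := jacobiMoment_shiftedJacobi m (c := c + 2) (s := -1) ha (by linarith)
    have e2 : a + (c + 2) + -1 + 2 = c + a + 2 + 1 := by ring
    rw [← e, neg_neg, poch_one, e2, ← hS] at h
    rw [h]
    field_simp
  rw [hg', jacobiMoment_add ha hc, h0, jacobiMoment_C_mul, jacobiMoment_X_mul a hc, h1,
    jacobiMoment_one_succ_right ha hc, poch_succ_left]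
  have p1 := poch_pos (show 0 < a + 1 by linarith) m
  have p2 := poch_pos (show 0 < c + a + 2 + 1 by linarith) m
  have p3 := jacobiMoment_one_pos ha hc
  have p4 : c + a + 2 ≠ 0 := by linarith
  have p5 : a + c + 2 = c + a + 2 := by ring
  rw [p5]
  field_simp
  ring

/-- The contribution of one edge to `⟨P_n, Q_n⟩`. -/
theorem jacobiMoment_mixed (m : ℕ) {a c : ℝ} (ha : -1 < a) (hc : -1 < c) :
    poch (c + a + 2) (m + 1) / poch (a + 1) m * ((jacobiMoment a c 1)⁻¹ *
      jacobiMoment a c (Polynomial.X * shiftedJacobi m (c + 2) a * shiftedJacobi (m + 1) c a)) =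
    -((a + m + 1) * poch (c + 1) (m + 1) / (m.factorial * (2 * (m + 1) + c + a + 1))) := by
  have hm : (0 : ℝ) ≤ m := m.cast_nonneg
  have hd : (Polynomial.X * shiftedJacobi m (c + 2) a).natDegree ≤ m + 1 := by
    refine Polynomial.natDegree_mul_le.trans ?_
    have := natDegree_shiftedJacobi_le m (c + 2) a
    rw [Polynomial.natDegree_X]
    omega
  have e1 : poch (m + (c + 2) + a + 1) m = poch (a + c + (m + 1 : ℕ) + 2) m := by
    congr 1; push_cast; ring
  have e2 : a + c + 2 = c + a + 2 := by ring
  -- Tested against P_{m+1}, the factor u S of degree at most m + 1 counts only through its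
  -- coefficient of u^(m+1).
  rw [jacobiMoment_mul_shiftedJacobi ha hc hd, Polynomial.coeff_X_mul, coeff_shiftedJacobi,
    if_pos le_rfl, jacobiCoeff_top, e1, e2, poch_succ (a + c + (m + 1 : ℕ) + 2),
    poch_succ (a + 1)]
  have p1 := poch_pos (show 0 < a + 1 by linarith) m
  have p2 := poch_pos (show 0 < c + a + 2 by linarith) (m + 1)
  have p3 := jacobiMoment_one_pos ha hc
  have p4 := poch_pos (show 0 < a + c + (m + 1 : ℕ) + 2 by push_cast; linarith) m
  have e3 : a + c + (m + 1 : ℕ) + 2 + m = 2 * (m + 1) + c + a + 1 := by push_cast; ring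
  have p5 : 2 * ((m : ℝ) + 1) + c + a + 1 ≠ 0 := by linarith
  have h2 : ((-1 : ℝ) ^ m) * (-1) ^ m = 1 := by rw [← mul_pow]; simp
  rw [e3, pow_succ]
  generalize 2 * ((m : ℝ) + 1) + c + a + 1 = D at p5 ⊢
  field_simp
  rw [sq, h2]
  ring

/-- The contribution of one edge to `⟨Q_n, Q_n⟩`. -/
theorem jacobiMoment_X_mul_shiftedJacobi_sq (m : ℕ) {a c : ℝ} (ha : -1 < a) (hc : -1 < c) :
    (jacobiMoment a c 1)⁻¹ * jacobiMoment a c ((Polynomial.X * shiftedJacobi m (c + 2) a) *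
      (Polynomial.X * shiftedJacobi m (c + 2) a)) =
    poch (c + 1) 2 / poch (a + c + 2) 2 * jacobiNormSq m a (c + 2) := by
  have h := jacobiMoment_X_pow_mul a hc (shiftedJacobi m (c + 2) a * shiftedJacobi m (c + 2) a) 2
  have h1 := jacobiMoment_add_natCast_one 2 ha hc
  push_cast at h h1
  have e : (Polynomial.X * shiftedJacobi m (c + 2) a) * (Polynomial.X * shiftedJacobi m (c + 2) a) =
    Polynomial.X ^ 2 * (shiftedJacobi m (c + 2) a * shiftedJacobi m (c + 2) a) := by ring
  rw [e, h, jacobiNormSq_eq_moment, h1]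
  have p1 := poch_pos (show 0 < c + 1 by linarith) 2
  have p2 := poch_pos (show 0 < a + c + 2 by linarith) 2
  have p3 := jacobiMoment_one_pos ha hc
  field_simp

/-! ### Combining the two edges. -/

/-- The edges contribute (γ+1) g(1,1) and its negative, the weight σ being absorbed by σ⁻¹ in Q_n.
The cancellation relies on the two weights sharing the exponent γ at the corner. -/
theorem jacobiWedgeForm_wedgeQ_eq_zero {α β γ σ : ℝ} (hα : -1 < α) (hβ : -1 < β) (hγ : -1 < γ)
    (hσ : 0 < σ) {m : ℕ} {g : MvPolynomial (Fin 2) ℝ} (hg : g.totalDegree ≤ m) :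
    jacobiWedgeForm α β γ σ (wedgeQ α β γ σ (m + 1)) g = 0 := by
  have h1 := jacobiMoment_X_mul_shiftedJacobi_mul hα hγ ((natDegree_edgeX_le g).trans hg)
  have h2 := jacobiMoment_X_mul_shiftedJacobi_mul hβ hγ ((natDegree_edgeY_le g).trans hg)
  rw [jacobiWedgeForm_eq, edgeX_wedgeQ, edgeY_wedgeQ, mul_assoc, mul_assoc (Polynomial.C _),
    jacobiMoment_C_mul, jacobiMoment_C_mul]
  rw [← coeff_zero_edgeX_eq] at h2
  have h3 : σ * σ⁻¹ = 1 := mul_inv_cancel₀ hσ.ne'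
  linear_combination h1 - σ * σ⁻¹ * h2 - (γ + 1) * (edgeX g).coeff 0 * h3

theorem jacobiWedgeForm_wedgeP_wedgeQ {α β γ σ : ℝ} (hα : -1 < α) (hβ : -1 < β) (hγ : -1 < γ)
    (hσ : 0 < σ) (m : ℕ) :
    jacobiWedgeForm α β γ σ (wedgeP α β γ (m + 1)) (wedgeQ α β γ σ (m + 1)) =
      (β - α) * poch (γ + 1) (m + 2) /
        ((2 * (m + 1) + γ + α + 1) * (2 * (m + 1) + γ + β + 1) * (m.factorial : ℝ)) := by
  have hm : (0 : ℝ) ≤ m := m.cast_nonneg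
  have h1 := jacobiMoment_mixed m hα hγ
  have h2 := jacobiMoment_mixed m hβ hγ
  have h3 : σ * σ⁻¹ = 1 := mul_inv_cancel₀ hσ.ne'
  have p1 : 2 * ((m : ℝ) + 1) + γ + α + 1 ≠ 0 := by linarith
  have p2 : 2 * ((m : ℝ) + 1) + γ + β + 1 ≠ 0 := by linarith
  rw [jacobiWedgeForm_eq, edgeX_wedgeP, edgeY_wedgeP, edgeX_wedgeQ, edgeY_wedgeQ, mul_left_comm,
    mul_comm (shiftedJacobi (m + 1) γ α), mul_left_comm (shiftedJacobi (m + 1) γ β),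
    mul_comm (shiftedJacobi (m + 1) γ β), jacobiMoment_C_mul, jacobiMoment_C_mul]
  trans -((α + m + 1) * poch (γ + 1) (m + 1) / (m.factorial * (2 * (m + 1) + γ + α + 1))) +
    ((β + m + 1) * poch (γ + 1) (m + 1) / (m.factorial * (2 * (m + 1) + γ + β + 1)))
  · rw [← h1]
    have h2' := congrArg Neg.neg h2
    rw [neg_neg] at h2'
    rw [← h2', mul_left_comm (jacobiMoment α γ 1)⁻¹, mul_left_comm (jacobiMoment β γ 1)⁻¹, neg_mul,
      mul_neg, mul_assoc σ⁻¹, mul_inv_cancel_left₀ hσ.ne']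
  -- With N = m + 1: (β+N)(2N+γ+α+1) - (α+N)(2N+γ+β+1) = (β-α)(γ+N+1), and γ+N+1 is the last factor
  -- of (γ+1)_{m+2}.
  · rw [poch_succ _ (m + 1)]
    push_cast
    obtain ⟨D, hD⟩ : ∃ D, D = 2 * ((m : ℝ) + 1) + γ + α + 1 := ⟨_, rfl⟩
    obtain ⟨E, hE⟩ : ∃ E, E = 2 * ((m : ℝ) + 1) + γ + β + 1 := ⟨_, rfl⟩
    rw [← hD, ← hE]
    rw [← hD] at p1
    rw [← hE] at p2
    field_simp
    rw [hD, hE]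
    ring

/-- The edge x = 1 keeps σ⁻¹ because σ (σ⁻¹)² = σ⁻¹. -/
theorem jacobiWedgeForm_wedgeQ_self {α β γ σ : ℝ} (hα : -1 < α) (hβ : -1 < β) (hγ : -1 < γ)
    (hσ : 0 < σ) (m : ℕ) :
    jacobiWedgeForm α β γ σ (wedgeQ α β γ σ (m + 1)) (wedgeQ α β γ σ (m + 1)) =
        poch (γ + 1) 2 * poch (α + γ + 2) (m + 1) ^ 2 /
            (poch (α + γ + 2) 2 * poch (α + 1) m ^ 2) * jacobiNormSq m α (γ + 2) +
          σ⁻¹ * (poch (γ + 1) 2 * poch (β + γ + 2) (m + 1) ^ 2 /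
            (poch (β + γ + 2) 2 * poch (β + 1) m ^ 2) * jacobiNormSq m β (γ + 2)) := by
  have h1 := jacobiMoment_X_mul_shiftedJacobi_sq m hα hγ
  have h2 := jacobiMoment_X_mul_shiftedJacobi_sq m hβ hγ
  have hsq : ∀ (r : ℝ) (p : Polynomial ℝ), Polynomial.C r * p * (Polynomial.C r * p) =
      Polynomial.C (r * r) * (p * p) := fun r p => by rw [mul_mul_mul_comm, Polynomial.C_mul]
  rw [jacobiWedgeForm_eq, edgeX_wedgeQ, edgeY_wedgeQ, hsq, hsq, jacobiMoment_C_mul, jacobiMoment_C_mul,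
    mul_left_comm (jacobiMoment α γ 1)⁻¹, mul_left_comm (jacobiMoment β γ 1)⁻¹, h1, h2,
    add_comm γ α, add_comm γ β]
  field_simp

/-- Each edge integral vanishes separately, as the restrictions of g have degree below n. -/
theorem jacobiWedgeForm_wedgeP_eq_zero {α β γ σ : ℝ} (hα : -1 < α) (hβ : -1 < β) (hγ : -1 < γ)
    {n : ℕ} {g : MvPolynomial (Fin 2) ℝ} (hg : g.totalDegree < n) :
    jacobiWedgeForm α β γ σ (wedgeP α β γ n) g = 0 := by
  have hX := natDegree_edgeX_le g
  have hY := natDegree_edgeY_le g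
  rw [jacobiWedgeForm_eq, edgeX_wedgeP, edgeY_wedgeP, mul_comm (shiftedJacobi n γ α),
    mul_comm (shiftedJacobi n γ β), jacobiMoment_mul_shiftedJacobi hα hγ (by omega),
    jacobiMoment_mul_shiftedJacobi hβ hγ (by omega),
    Polynomial.coeff_eq_zero_of_natDegree_lt (p := edgeX g) (by omega),
    Polynomial.coeff_eq_zero_of_natDegree_lt (p := edgeY g) (by omega)]
  ring

end

theorem theorem2p4 (α β γ σ : ℝ) (hα : -1 < α) (hβ : -1 < β) (hγ : -1 < γ) (hσ : 0 < σ) :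
    -- membership in the orthogonal spaces
    (∀ n : ℕ, Ideal.Quotient.mk wedgeIdeal (wedgeP α β γ n) ∈ jacobiWedgeOrthSpace α β γ σ n) ∧
    (∀ n : ℕ, 1 ≤ n →
      Ideal.Quotient.mk wedgeIdeal (wedgeQ α β γ σ n) ∈ jacobiWedgeOrthSpace α β γ σ n) ∧
    -- the mixed inner product
    (∀ n : ℕ, 1 ≤ n →
      jacobiWedgeForm α β γ σ (wedgeP α β γ n) (wedgeQ α β γ σ n) =
        (β - α) * poch (γ + 1) (n + 1) /
          ((2 * n + γ + α + 1) * (2 * n + γ + β + 1) * ((n - 1).factorial : ℝ))) ∧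
    (β = α → ∀ n : ℕ, 1 ≤ n →
      jacobiWedgeForm α β γ σ (wedgeP α β γ n) (wedgeQ α β γ σ n) = 0) ∧
    -- the norms
    (∀ n : ℕ, jacobiWedgeForm α β γ σ (wedgeP α β γ n) (wedgeP α β γ n) =
      jacobiNormSq n α γ + σ * jacobiNormSq n β γ) ∧
    (∀ n : ℕ, 1 ≤ n →
      jacobiWedgeForm α β γ σ (wedgeQ α β γ σ n) (wedgeQ α β γ σ n) =
        poch (γ + 1) 2 * poch (α + γ + 2) n ^ 2 /
            (poch (α + γ + 2) 2 * poch (α + 1) (n - 1) ^ 2) * jacobiNormSq (n - 1) α (γ + 2) +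
          σ⁻¹ * (poch (γ + 1) 2 * poch (β + γ + 2) n ^ 2 /
            (poch (β + γ + 2) 2 * poch (β + 1) (n - 1) ^ 2) * jacobiNormSq (n - 1) β (γ + 2))) ∧
    -- the closed form of the Jacobi norms that occur above
    (∀ a c : ℝ, -1 < a → -1 < c → ∀ n : ℕ, n ≠ 0 ∨ c + a + 1 ≠ 0 →
      jacobiNormSq n a c =
        poch (c + 1) n * poch (a + 1) n * (n + c + a + 1) /
          ((n.factorial : ℝ) * poch (c + a + 2) n * (2 * n + c + a + 1))) := by
  have mixed : ∀ n : ℕ, 1 ≤ n →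
      jacobiWedgeForm α β γ σ (wedgeP α β γ n) (wedgeQ α β γ σ n) =
        (β - α) * poch (γ + 1) (n + 1) /
          ((2 * n + γ + α + 1) * (2 * n + γ + β + 1) * ((n - 1).factorial : ℝ)) := by
    intro n hn
    obtain ⟨m, rfl⟩ := Nat.exists_eq_add_of_le' hn
    have h := jacobiWedgeForm_wedgeP_wedgeQ hα hβ hγ hσ m
    simpa using h
  refine ⟨fun n => ⟨_, rfl, totalDegree_wedgeP_le α β γ n, fun g hg =>
      jacobiWedgeForm_wedgeP_eq_zero hα hβ hγ hg⟩, ?_, mixed, ?_, ?_, ?_, ?_⟩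
  · intro n hn
    obtain ⟨m, rfl⟩ := Nat.exists_eq_add_of_le' hn
    exact ⟨_, rfl, totalDegree_wedgeQ_le α β γ σ m, fun g hg =>
      jacobiWedgeForm_wedgeQ_eq_zero hα hβ hγ hσ (Nat.lt_succ_iff.mp hg)⟩
  · intro h n hn
    rw [mixed n hn, h, sub_self, zero_mul, zero_div]
  · intro n
    rw [jacobiWedgeForm_eq, edgeX_wedgeP, edgeY_wedgeP, ← jacobiNormSq_eq_moment,
      ← jacobiNormSq_eq_moment]
  · intro n hn
    obtain ⟨m, rfl⟩ := Nat.exists_eq_add_of_le' hn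
    exact jacobiWedgeForm_wedgeQ_self hα hβ hγ hσ m
  · intro a c ha hc n h
    exact jacobiNormSq_eq n ha hc h
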